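/- **Setting.** Let $M\ge 2$ be an integer and let $\tau_1,\dots,\tau_N$ be sporadic tasks with worst-case execution times $C_i>0$, relative deadlines $D_i>0$ and minimum inter-arrival times $T_i>0$ (arbitrary deadlines: no relation between $D_i$ and $T_i$ is required). The tasks are indexed by decreasing priority, and the priorities are deadline-monotonic (DM): $D_i\le D_j$ for $i<j$, ties being broken arbitrarily. The task set is *feasible on $M$ unit-speed processors* if for every legal arrival sequence (consecutive jobs of $\tau_i$ arrive at least $T_i$ apart) there is a preemptive schedule with free migration on $M$ processors, in which at each instant at most one job of each task is executed and on at most one processor, and no job is executed before its arrival, such that each job of $\tau_i$ arriving at $a$ receives $C_i$ units of execution in $[a,a+D_i)$. Running the platform at speed $s$ replaces each $C_i$ by $C_i/s$. **Notation.** $U_i=C_i/T_i$, $\delta_i=C_i/\min\{D_i,T_i\}$, $U^{\max}_{\delta,k}=\max\{\max_{i<k}U_i,\ \delta_k\}$, $\mu(\rho)=M-(M-1)\rho$, $D'_{k,\ell}=(\ell-1)T_k+D_k$. For $t\ge 0$, $$work_i(t)=\lfloor t/T_i\rfloor C_i+\min\{C_i,\ t-\lfloor t/T_i\rfloor T_i\}.$$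 For $\Delta>0$ let $\omega^{heavy}_i(\Delta)=work_i(\Delta+D_i)$; let $\omega^{light}_i(\Delta,\rho)=\Delta$ if $\Delta\le C_i$, and otherwise $$\omega^{light}_i(\Delta,\rho)=\max\{work_i(\Delta),\ (p+1)C_i+\max\{0,\,C_i-\rho(T_i-q)\}\},$$ where $p=\lceil(\Delta-C_i)/T_i\rceil-1$ and $q=\Delta-C_i-pT_i$. Let $\omega^{diff}_i(\Delta,\rho)$ be $\omega^{heavy}_i(\Delta)-work_i(\Delta)$ if $U_i>\rho$, and $\omega^{light}_i(\Delta,\rho)-work_i(\Delta)$ if $U_i\le\rho$. Let $\gamma_i(\rho)=1$ if $U_i>\rho$ and $\gamma_i(\rho)=0$ otherwise. For a function $f$ on the tasks, let $\mathrm{Top}_\rho f$ denote the sum of its $\lceil\mu(\rho)\rceil-1$ largest values over $\{1,\dots,k-1\}$ (of all $k-1$ values if there are fewer). **Tests.** Each of the following conditions is a schedulability test for the task $\tau_k$ under global fixed-priority scheduling. 1. For all integers $\ell\ge1$ there is $\rho$ with $\ell C_k/D'_{k,\ell}\le\rho\le1$ such that for all $\Delta\ge D'_{k,\ell}$: $$\ell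 C_k+\mathrm{Top}_\rho\big(\omega^{diff}_i(\Delta,\rho)\big)+\sum_{i<k}work_i(\Delta)\le\Delta\,\mu(\rho).$$ 2. For all integers $\ell\ge1$ there is $\rho$ with $\ell C_k/D'_{k,\ell}\le\rho\le1$ such that $$\frac{\ell C_k}{D'_{k,\ell}}+\frac{\mathrm{Top}_\rho\big(\gamma_i(\rho)U_iD_i\big)}{D'_{k,\ell}}+\sum_{i<k}\Big(\frac{C_i-C_iU_i}{D'_{k,\ell}}+U_i\Big)\le\mu(\rho).$$ 3. For all integers $\ell\ge1$: $$\frac{\ell C_k}{D'_{k,\ell}}+\sum_{i<k}\Big(\frac{C_i-C_iU_i}{D'_{k,\ell}}+U_i\Big)\le\mu(U^{\max}_{\delta,k}).$$ 4. With $b=(D_k-T_k)/T_k$: if $bU_k-\sum_{i<k}\frac{C_i-C_iU_i}{T_k}>0$, then $\sum_{i\le k}U_i\le\mu(U^{\max}_{\delta,k})$; otherwise $\frac{C_k}{D_k}+\sum_{i<k}\big(\frac{C_i-C_iU_i}{D_k}+U_i\big)\le\mu(U^{\max}_{\delta,k})$. 5. $\displaystyle\delta_k+\sum_{i<k}\Big(\frac{C_i-C_iU_i}{D_k}+U_i\Big)\le\mu(U^{\max}_{\delta,k}).$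 **Theorem.** For global DM scheduling on $M\ge2$ processors, each of the five tests has speedup bound $3-\frac1M$ with respect to the optimal schedule. That is, if a task set indexed in DM order is feasible on $M$ unit-speed processors, then each of the tests, applied with all execution times $C_i$ replaced by $C_i/(3-\frac1M)$, accepts every task $\tau_k$, $1\le k\le N$. -/

import Mathlib

noncomputable section

namespace Sporadic

/-- Parameters of `N` sporadic tasks: worst-case execution time `C i`, relative deadline `D i`
and minimum inter-arrival time (period) `T i`.  Priorities are given by the index: task `i` has
higher priority than task `j` iff `i < j`.  No relation between `D i` and `T i` is required
(arbitrary deadlines). -/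
structure TaskSet (N : ℕ) where
  C : Fin N → ℝ
  D : Fin N → ℝ
  T : Fin N → ℝ

namespace TaskSet

variable {N : ℕ}

/-- All parameters are positive. -/
def Positive (τ : TaskSet N) : Prop :=
  ∀ i, 0 < τ.C i ∧ 0 < τ.D i ∧ 0 < τ.T i

/-- The index order is a deadline-monotonic priority order (ties broken arbitrarily). -/
def IsDeadlineMonotonic (τ : TaskSet N) : Prop :=
  ∀ i j, i < j → τ.D i ≤ τ.D j

/-- The task set as seen on a platform of speed `s`: execution times become `C i / s`. -/
def atSpeed (τ : TaskSet N) (s : ℝ) : TaskSet N where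
  C := fun i => τ.C i / s
  D := τ.D
  T := τ.T

/-- Utilization `U i = C i / T i`. -/
def U (τ : TaskSet N) (i : Fin N) : ℝ := τ.C i / τ.T i

/-- Density `δ i = C i / min (D i) (T i)`. -/
def density (τ : TaskSet N) (i : Fin N) : ℝ := τ.C i / min (τ.D i) (τ.T i)

/-- The maximum of the density of task `k` and the utilizations of the tasks `i < k`. -/
def Umax (τ : TaskSet N) (k : Fin N) : ℝ :=
  (Finset.Iio k).fold max (τ.density k) τ.U

end TaskSet

/-! ### Feasibility on `M` identical unit-speed processors -/

/-- A legal arrival sequence: `r i n` is the arrival time of the `n`-th job of task `i`, and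
consecutive arrivals of jobs of task `i` are separated by at least `T i`. -/
def IsLegalArrival {N : ℕ} (τ : TaskSet N) (r : Fin N → ℕ → ℝ) : Prop :=
  ∀ i, 0 ≤ r i 0 ∧ ∀ n, r i n + τ.T i ≤ r i (n + 1)

/-- A preemptive schedule with free migration on `M` processors: `run p t` is the job (task and
job number) that processor `p` executes at time `t`, or `none` if `p` idles.  At each instant at
most one job of each task is executed, on at most one processor (no intra-task parallelism). -/
structure Schedule (M N : ℕ) where
  run : Fin M → ℝ → Option (Fin N × ℕ)
  measurableSet_run : ∀ p i n, MeasurableSet {t | run p t = some (i, n)}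
  no_parallelism : ∀ t p p' i n n',
    run p t = some (i, n) → run p' t = some (i, n') → p = p'

/-- The amount of execution that the `n`-th job of task `i` receives in `[a, b)` (at speed 1). -/
def Schedule.service {M N : ℕ} (σ : Schedule M N) (i : Fin N) (n : ℕ) (a b : ℝ) : ENNReal :=
  ∑ p, MeasureTheory.volume ({t | σ.run p t = some (i, n)} ∩ Set.Ico a b)

/-- The schedule serves the arrival sequence `r`: no job is executed before it arrives, and each
job receives its worst-case execution time between its arrival and its absolute deadline. -/
def Schedule.MeetsDeadlines {M N : ℕ} (σ : Schedule M N) (τ : TaskSet N)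
    (r : Fin N → ℕ → ℝ) : Prop :=
  (∀ p t i n, σ.run p t = some (i, n) → r i n ≤ t) ∧
  ∀ i n, ENNReal.ofReal (τ.C i) ≤ σ.service i n (r i n) (r i n + τ.D i)

/-- An optimal (clairvoyant) scheduler meets all deadlines on `M` unit-speed processors:
every legal arrival sequence has a schedule in which all jobs meet their deadlines. -/
def Feasible {N : ℕ} (M : ℕ) (τ : TaskSet N) : Prop :=
  ∀ r, IsLegalArrival τ r → ∃ σ : Schedule M N, σ.MeetsDeadlines τ r

/-! ### Workload functions -/

namespace TaskSet

variable {N : ℕ}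

/-- The workload function `work i t` (used for `t ≥ 0` only). -/
def work (τ : TaskSet N) (i : Fin N) (t : ℝ) : ℝ :=
  (⌊t / τ.T i⌋ : ℝ) * τ.C i + min (τ.C i) (t - (⌊t / τ.T i⌋ : ℝ) * τ.T i)

/-- Carry-in workload of a heavy task. -/
def heavy (τ : TaskSet N) (i : Fin N) (Δ : ℝ) : ℝ := τ.work i (Δ + τ.D i)

/-- Carry-in workload of a light task, for `Δ > 0`, with
`p₂ = ⌈(Δ - C i) / T i⌉ - 1` and `q₂ = Δ - C i - p₂ T i`. -/
def light (τ : TaskSet N) (i : Fin N) (ρ Δ : ℝ) : ℝ :=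
  if Δ ≤ τ.C i then Δ
  else
    let p₂ : ℝ := (⌈(Δ - τ.C i) / τ.T i⌉ : ℝ) - 1
    let q₂ : ℝ := Δ - τ.C i - p₂ * τ.T i
    max (τ.work i Δ) ((p₂ + 1) * τ.C i + max 0 (τ.C i - ρ * (τ.T i - q₂)))

open Classical in
/-- The additional workload of task `i` if it is a carry-in task. -/
def omegaDiff (τ : TaskSet N) (i : Fin N) (ρ Δ : ℝ) : ℝ :=
  if ρ < τ.U i then τ.heavy i Δ - τ.work i Δ else τ.light i ρ Δ - τ.work i Δ

open Classical in
/-- `γ i = 1` if `U i > ρ` and `γ i = 0` otherwise. -/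
def gamma (τ : TaskSet N) (i : Fin N) (ρ : ℝ) : ℝ := if ρ < τ.U i then 1 else 0

end TaskSet

/-- `μ = M - (M - 1) ρ`. -/
def mu (M : ℕ) (ρ : ℝ) : ℝ := (M : ℝ) - ((M : ℝ) - 1) * ρ

/-- `S` consists of the `m` elements of `A` with the largest values of `f`
(all of `A` if `A` has fewer than `m` elements; ties are broken arbitrarily). -/
def IsLargest {ι : Type*} (A : Finset ι) (f : ι → ℝ) (m : ℕ) (S : Finset ι) : Prop :=
  S ⊆ A ∧ S.card = min m A.card ∧ ∀ i ∈ S, ∀ j ∈ A, j ∉ S → f j ≤ f i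

/-- The `ℓ`-job window length `D'_k = (ℓ - 1) T_k + D_k`. -/
def TaskSet.window {N : ℕ} (τ : TaskSet N) (k : Fin N) (ℓ : ℕ) : ℝ :=
  ((ℓ : ℝ) - 1) * τ.T k + τ.D k

/-! ### The schedulability tests

Each is a condition on `M` processors, a task set and the task `k` under analysis; the
higher-priority tasks are those in `Finset.Iio k`. -/

/-- The test with exact workload functions. -/
def workloadTest (N M : ℕ) (τ : TaskSet N) (k : Fin N) : Prop :=
  ∀ ℓ : ℕ, 1 ≤ ℓ → ∃ ρ : ℝ, ρ ≤ 1 ∧ (ℓ : ℝ) * τ.C k / τ.window k ℓ ≤ ρ ∧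
    ∀ Δ : ℝ, τ.window k ℓ ≤ Δ →
      ∃ S : Finset (Fin N),
        IsLargest (Finset.Iio k) (fun i => τ.omegaDiff i ρ Δ) (⌈mu M ρ⌉₊ - 1) S ∧
        (ℓ : ℝ) * τ.C k + ∑ i ∈ S, τ.omegaDiff i ρ Δ + ∑ i ∈ Finset.Iio k, τ.work i Δ
          ≤ Δ * mu M ρ

/-- The test with linear approximations of the workload functions. -/
def linearApproxTest (N M : ℕ) (τ : TaskSet N) (k : Fin N) : Prop :=
  ∀ ℓ : ℕ, 1 ≤ ℓ → ∃ ρ : ℝ, ρ ≤ 1 ∧ (ℓ : ℝ) * τ.C k / τ.window k ℓ ≤ ρ ∧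
    ∃ S : Finset (Fin N),
      IsLargest (Finset.Iio k) (fun i => τ.gamma i ρ * τ.U i * τ.D i) (⌈mu M ρ⌉₊ - 1) S ∧
      (ℓ : ℝ) * τ.C k / τ.window k ℓ
        + ∑ i ∈ S, τ.gamma i ρ * τ.U i * τ.D i / τ.window k ℓ
        + ∑ i ∈ Finset.Iio k, ((τ.C i - τ.C i * τ.U i) / τ.window k ℓ + τ.U i)
        ≤ mu M ρ

/-- The test with `ρ` set to `Umax k`, for all `ℓ`. -/
def allEllTest (N M : ℕ) (τ : TaskSet N) (k : Fin N) : Prop :=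
  ∀ ℓ : ℕ, 1 ≤ ℓ →
    (ℓ : ℝ) * τ.C k / τ.window k ℓ
      + ∑ i ∈ Finset.Iio k, ((τ.C i - τ.C i * τ.U i) / τ.window k ℓ + τ.U i)
      ≤ mu M (τ.Umax k)

/-- The condition of the two-case closed-form test (the worst case is `ℓ → ∞` or `ℓ = 1`). -/
def closedFormTest (N M : ℕ) (τ : TaskSet N) (k : Fin N) : Prop :=
  let b : ℝ := (τ.D k - τ.T k) / τ.T k
  (0 < b * τ.U k - ∑ i ∈ Finset.Iio k, (τ.C i - τ.C i * τ.U i) / τ.T k →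
    ∑ i ∈ Finset.Iic k, τ.U i ≤ mu M (τ.Umax k)) ∧
  (¬ 0 < b * τ.U k - ∑ i ∈ Finset.Iio k, (τ.C i - τ.C i * τ.U i) / τ.T k →
    τ.C k / τ.D k + ∑ i ∈ Finset.Iio k, ((τ.C i - τ.C i * τ.U i) / τ.D k + τ.U i)
      ≤ mu M (τ.Umax k))

/-- The linear-time density-based test. -/
def densityTest (N M : ℕ) (τ : TaskSet N) (k : Fin N) : Prop :=
  τ.density k + ∑ i ∈ Finset.Iio k, ((τ.C i - τ.C i * τ.U i) / τ.D k + τ.U i)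
    ≤ mu M (τ.Umax k)

/-- A schedulability test has speedup bound `s` for global deadline-monotonic scheduling on `M`
processors, with respect to the optimal schedule: whenever a task set, indexed in
deadline-monotonic priority order, can be feasibly scheduled by some scheduler on `M` processors
of speed `1`, the test deems every task schedulable when all processors run at speed `s`. -/
def HasSpeedupBoundDM (M : ℕ) (test : (N M : ℕ) → TaskSet N → Fin N → Prop) (s : ℝ) : Prop :=
  0 < s ∧ ∀ (N : ℕ) (τ : TaskSet N), τ.Positive → τ.IsDeadlineMonotonic → Feasible M τ →
    ∀ k : Fin N, test N M (τ.atSpeed s) k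

end Sporadic

end

/-! The density test implies the other four, so only it needs a speedup bound. Feasibility at unit
speed forces `U i ≤ 1`, `C i ≤ D i`, `∑ U i ≤ M` and, by deadline monotonicity, `∑_{i ≤ k} C i ≤ M *
D k`. The density of `k` is `C k / D k` or `U k`, so it is absorbed by one of the two sums, and the
left side of the test at speed `s` is at most `2M/s` (`Feasible.density_add_sum_le`). As `Umax ≤
1/s`, the right side is at least `M - (M-1)/s`; the two agree exactly for `s = 3 - 1/M`. For the
implications take `ρ = Umax k`: every task `i < k` is then light, and with or without carry-in its
workload is at most the affine function `C - C*U + U*Δ` (`work_le_linear`, `light_le_linear`). -/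

namespace Sporadic

open MeasureTheory Finset

/-! ### Demand bounds for feasible task sets -/

section Demand

variable {M N : ℕ} {τ : TaskSet N} {r : Fin N → ℕ → ℝ}

/-- The demand of finitely many jobs whose execution intervals lie in `[a, b)` and which run on
pairwise disjoint parts of `m` copies of `[a, b)` is at most `m (b - a)`. -/
theorem sum_C_le_of_sum_service_le {σ : Schedule M N} (hpos : τ.Positive)
    (hσ : σ.MeetsDeadlines τ r) {a b : ℝ} (hab : a ≤ b) (m : ℕ) (J : Finset (Fin N × ℕ))
    (hJ : ∀ j ∈ J, a ≤ r j.1 j.2 ∧ r j.1 j.2 + τ.D j.1 ≤ b)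
    (hs : ∑ j ∈ J, σ.service j.1 j.2 a b ≤ m * volume (Set.Ico a b)) :
    ∑ j ∈ J, τ.C j.1 ≤ m * (b - a) := by
  have hle : ∑ j ∈ J, ENNReal.ofReal (τ.C j.1) ≤ m * volume (Set.Ico a b) := by
    refine le_trans (Finset.sum_le_sum fun j hj => (hσ.2 j.1 j.2).trans ?_) hs
    refine Finset.sum_le_sum fun p _ => measure_mono ?_
    exact Set.inter_subset_inter_right _ (Set.Ico_subset_Ico (hJ j hj).1 (hJ j hj).2)
  rw [← ENNReal.ofReal_sum_of_nonneg fun j _ => (hpos j.1).1.le, Real.volume_Ico,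
    ← ENNReal.ofReal_natCast, ← ENNReal.ofReal_mul (Nat.cast_nonneg m)] at hle
  exact (ENNReal.ofReal_le_ofReal_iff
    (mul_nonneg (Nat.cast_nonneg m) (sub_nonneg.2 hab))).1 hle

/-- A processor runs one job at a time, so on each processor the execution sets of distinct jobs are
disjoint. -/
theorem Schedule.sum_service_le (σ : Schedule M N) (J : Finset (Fin N × ℕ)) (a b : ℝ) :
    ∑ j ∈ J, σ.service j.1 j.2 a b ≤ M * volume (Set.Ico a b) := by
  unfold Schedule.service
  rw [Finset.sum_comm]
  have h : ∀ p ∈ (univ : Finset (Fin M)),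
      ∑ j ∈ J, volume ({t | σ.run p t = some (j.1, j.2)} ∩ Set.Ico a b)
        ≤ volume (Set.Ico a b) := by
    intro p _
    rw [← measure_biUnion_finset]
    · exact measure_mono (Set.iUnion₂_subset fun _ _ => Set.inter_subset_right)
    · intro j _ j' _ hne
      refine Set.disjoint_left.2 fun t ht ht' => hne ?_
      have h1 : σ.run p t = some (j.1, j.2) := ht.1
      have h2 : σ.run p t = some (j'.1, j'.2) := ht'.1
      exact Option.some.inj (h1.symm.trans h2)
    · exact fun j _ => (σ.measurableSet_run p j.1 j.2).inter measurableSet_Ico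
  refine (Finset.sum_le_sum h).trans ?_
  simp

/-- For jobs of one task, `no_parallelism` makes the execution sets disjoint across processors as
well, so the factor `M` disappears. The individual bounds `U i ≤ 1` and `C i ≤ D i` rest on this. -/
theorem Schedule.sum_service_le_of_task (σ : Schedule M N) (J : Finset (Fin N × ℕ)) (i : Fin N)
    (hJ : ∀ j ∈ J, j.1 = i) (a b : ℝ) :
    ∑ j ∈ J, σ.service j.1 j.2 a b ≤ volume (Set.Ico a b) := by
  unfold Schedule.service
  rw [← Finset.sum_product', ← measure_biUnion_finset
    (f := fun x : (Fin N × ℕ) × Fin M =>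
      {t | σ.run x.2 t = some (x.1.1, x.1.2)} ∩ Set.Ico a b)]
  · exact measure_mono (Set.iUnion₂_subset fun _ _ => Set.inter_subset_right)
  · rintro ⟨⟨i₁, n⟩, p⟩ hx ⟨⟨i₂, n'⟩, p'⟩ hx' hne
    refine Set.disjoint_left.2 fun t ht ht' => hne ?_
    have h1 : σ.run p t = some (i₁, n) := ht.1
    have h2 : σ.run p' t = some (i₂, n') := ht'.1
    have e1 : i₁ = i := hJ _ (Finset.mem_product.1 (Finset.mem_coe.1 hx)).1
    have e2 : i₂ = i := hJ _ (Finset.mem_product.1 (Finset.mem_coe.1 hx')).1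
    subst e1 e2
    have hp := σ.no_parallelism t p p' _ n n' h1 h2
    subst hp
    have := Option.some.inj (h1.symm.trans h2)
    simp [this]
  · exact fun x _ => (σ.measurableSet_run x.2 x.1.1 x.1.2).inter measurableSet_Ico

/-- Every task releases jobs strictly periodically from time `0` on. -/
theorem isLegalArrival_periodic (τ : TaskSet N) :
    IsLegalArrival τ fun i n => (n : ℝ) * τ.T i := by
  refine fun i => ⟨by simp, fun n => le_of_eq ?_⟩
  push_cast
  ring

/-- The jobs among the first `n i` ones of the tasks `i ∈ A`. -/
def initialJobs (A : Finset (Fin N)) (n : Fin N → ℕ) : Finset (Fin N × ℕ) :=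
  (A.sigma fun i => range (n i)).map (Equiv.sigmaEquivProd (Fin N) ℕ).toEmbedding

theorem sum_initialJobs (A : Finset (Fin N)) (n : Fin N → ℕ) (f : Fin N → ℝ) :
    ∑ j ∈ initialJobs A n, f j.1 = ∑ i ∈ A, n i * f i := by
  simp [initialJobs, Finset.sum_sigma]

theorem mem_initialJobs {A : Finset (Fin N)} {n : Fin N → ℕ} {j : Fin N × ℕ} :
    j ∈ initialJobs A n ↔ j.1 ∈ A ∧ j.2 < n j.1 := by
  obtain ⟨i, m⟩ := j
  simp [initialJobs]

theorem initialJobs_window (hpos : τ.Positive) {A : Finset (Fin N)} {n : Fin N → ℕ} {L : ℝ}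
    (hn : ∀ i ∈ A, ((n i : ℝ) - 1) * τ.T i + τ.D i ≤ L) (j : Fin N × ℕ)
    (hj : j ∈ initialJobs A n) :
    0 ≤ (j.2 : ℝ) * τ.T j.1 ∧ (j.2 : ℝ) * τ.T j.1 + τ.D j.1 ≤ L := by
  obtain ⟨hA, hlt⟩ := mem_initialJobs.1 hj
  have hT := (hpos j.1).2.2
  have hcast : (j.2 : ℝ) ≤ (n j.1 : ℝ) - 1 := by
    have : (j.2 : ℝ) + 1 ≤ n j.1 := by exact_mod_cast hlt
    linarith
  exact ⟨by positivity, by nlinarith [hn _ hA, mul_le_mul_of_nonneg_right hcast hT.le]⟩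

theorem Feasible.sum_demand_le (h : Feasible M τ) (hpos : τ.Positive) (A : Finset (Fin N))
    (n : Fin N → ℕ) {L : ℝ} (hL : 0 ≤ L)
    (hn : ∀ i ∈ A, ((n i : ℝ) - 1) * τ.T i + τ.D i ≤ L) :
    ∑ i ∈ A, n i * τ.C i ≤ M * L := by
  obtain ⟨σ, hσ⟩ := h _ (isLegalArrival_periodic τ)
  have := sum_C_le_of_sum_service_le hpos hσ hL M (initialJobs A n)
    (initialJobs_window hpos hn) (σ.sum_service_le _ _ _)
  rwa [sum_initialJobs, sub_zero] at this

theorem Feasible.task_demand_le (h : Feasible M τ) (hpos : τ.Positive) (i : Fin N)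
    (n : ℕ) {L : ℝ} (hL : 0 ≤ L) (hn : ((n : ℝ) - 1) * τ.T i + τ.D i ≤ L) :
    n * τ.C i ≤ L := by
  obtain ⟨σ, hσ⟩ := h _ (isLegalArrival_periodic τ)
  have hA : ∀ j ∈ ({i} : Finset (Fin N)), (((fun _ => n) j : ℕ) - 1 : ℝ) * τ.T j + τ.D j ≤ L := by
    simpa using hn
  have := sum_C_le_of_sum_service_le hpos hσ hL 1 (initialJobs {i} fun _ => n)
    (initialJobs_window hpos hA) (by
      simpa using σ.sum_service_le_of_task (initialJobs {i} fun _ => n) i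
        (fun j hj => by simpa using (mem_initialJobs.1 hj).1) 0 L)
  rw [sum_initialJobs] at this
  simpa using this

/-- Number of jobs of a task, released periodically from time `0`, that are due by time `L`. -/
theorem exists_jobCount (hpos : τ.Positive) {i : Fin N} {L : ℝ} (hL : τ.D i ≤ L) :
    ∃ n : ℕ, ((n : ℝ) - 1) * τ.T i + τ.D i ≤ L ∧ τ.U i * (L - τ.D i) ≤ n * τ.C i := by
  obtain ⟨hC, -, hT⟩ := hpos i
  have h0 : 0 ≤ (L - τ.D i) / τ.T i := div_nonneg (sub_nonneg.2 hL) hT.le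
  -- Job `0` is due at `D i` already; this extra job makes up for the rounding down.
  refine ⟨⌊(L - τ.D i) / τ.T i⌋₊ + 1, ?_, ?_⟩
  · have := (le_div_iff₀ hT).1 (Nat.floor_le h0)
    push_cast
    linarith
  · have := (Nat.lt_floor_add_one ((L - τ.D i) / τ.T i)).le
    calc τ.U i * (L - τ.D i) = (L - τ.D i) / τ.T i * τ.C i := by
          unfold TaskSet.U; ring
      _ ≤ _ := by push_cast; gcongr

/-- An affine function that is bounded above on a half-line has nonpositive slope. -/
theorem le_of_forall_ge_mul_sub_le {u v c L₀ : ℝ} (h : ∀ L, L₀ ≤ L → u * L - c ≤ v * L) :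
    u ≤ v := by
  by_contra! hlt
  have hd : 0 < u - v := sub_pos.2 hlt
  have := h (max L₀ ((c + 1) / (u - v))) (le_max_left _ _)
  have h2 := (div_le_iff₀ hd).1 (le_max_right L₀ ((c + 1) / (u - v)))
  linarith

theorem TaskSet.Positive.U_pos (hpos : τ.Positive) (i : Fin N) : 0 < τ.U i :=
  div_pos (hpos i).1 (hpos i).2.2

theorem Feasible.U_le_one (h : Feasible M τ) (hpos : τ.Positive) (i : Fin N) : τ.U i ≤ 1 := by
  refine le_of_forall_ge_mul_sub_le (c := τ.U i * τ.D i) (L₀ := τ.D i) fun L hL => ?_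
  obtain ⟨n, hn, hU⟩ := exists_jobCount hpos hL
  have := h.task_demand_le hpos i n ((hpos i).2.1.le.trans hL) hn
  linarith

theorem Feasible.C_le_D (h : Feasible M τ) (hpos : τ.Positive) (i : Fin N) : τ.C i ≤ τ.D i := by
  simpa using h.task_demand_le hpos i 1 (hpos i).2.1.le (by simp)

theorem Feasible.density_le_one (h : Feasible M τ) (hpos : τ.Positive) (i : Fin N) :
    τ.density i ≤ 1 := by
  have hm : 0 < min (τ.D i) (τ.T i) := lt_min (hpos i).2.1 (hpos i).2.2
  exact (div_le_one hm).2
    (le_min (h.C_le_D hpos i) ((div_le_one (hpos i).2.2).1 (h.U_le_one hpos i)))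

theorem Feasible.sum_U_le (h : Feasible M τ) (hpos : τ.Positive) (A : Finset (Fin N)) :
    ∑ i ∈ A, τ.U i ≤ M := by
  -- The sum of all deadlines is a convenient threshold beyond which every `D i ≤ L`.
  refine le_of_forall_ge_mul_sub_le (c := ∑ i ∈ A, τ.U i * τ.D i) (L₀ := ∑ i, τ.D i)
    fun L hL => ?_
  have hD : ∀ i, τ.D i ≤ L := fun i =>
    (Finset.single_le_sum (f := τ.D) (fun j _ => (hpos j).2.1.le) (Finset.mem_univ i)).trans hL
  have hL0 : 0 ≤ L := (Finset.sum_nonneg fun j _ => (hpos j).2.1.le).trans hL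
  choose n hn hU using fun i => exists_jobCount hpos (hD i)
  have h1 := h.sum_demand_le hpos A n hL0 fun i _ => hn i
  have h2 := Finset.sum_le_sum fun i (_ : i ∈ A) => hU i
  simp only [mul_sub, Finset.sum_sub_distrib, ← Finset.sum_mul] at h2
  linarith

/-- Under simultaneous release the first jobs of all tasks `i ≤ k` are due by `D k`. Deadline
monotonicity enters the proof here. -/
theorem Feasible.sum_C_le (h : Feasible M τ) (hpos : τ.Positive) (hDM : τ.IsDeadlineMonotonic)
    (k : Fin N) : ∑ i ∈ Iic k, τ.C i ≤ M * τ.D k := by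
  have := h.sum_demand_le hpos (Iic k) (fun _ => 1) (hpos k).2.1.le fun i hi => by
    rcases (Finset.mem_Iic.1 hi).eq_or_lt with rfl | hlt
    · simp
    · simpa using hDM i k hlt
  simpa using this

end Demand

/-! ### Basic bounds for utilizations, densities and windows -/

section Bounds

variable {N : ℕ} {τ : TaskSet N} {k : Fin N}

theorem TaskSet.density_le_Umax : τ.density k ≤ τ.Umax k :=
  (Finset.le_fold_max _).2 (Or.inl le_rfl)

theorem TaskSet.U_le_Umax {i : Fin N} (hi : i ∈ Iio k) : τ.U i ≤ τ.Umax k :=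
  (Finset.le_fold_max _).2 (Or.inr ⟨i, hi, le_rfl⟩)

theorem TaskSet.Umax_le {c : ℝ} (hδ : τ.density k ≤ c) (hU : ∀ i, τ.U i ≤ c) : τ.Umax k ≤ c :=
  (Finset.fold_max_le _).2 ⟨hδ, fun i _ => hU i⟩

theorem TaskSet.Positive.atSpeed (hpos : τ.Positive) {s : ℝ} (hs : 0 < s) :
    (τ.atSpeed s).Positive :=
  fun i => ⟨div_pos (hpos i).1 hs, (hpos i).2⟩

theorem TaskSet.atSpeed_U (τ : TaskSet N) (s : ℝ) (i : Fin N) :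
    (τ.atSpeed s).U i = τ.U i / s := by
  simp only [TaskSet.U, TaskSet.atSpeed]
  ring

theorem TaskSet.atSpeed_density (τ : TaskSet N) (s : ℝ) (i : Fin N) :
    (τ.atSpeed s).density i = τ.density i / s := by
  simp only [TaskSet.density, TaskSet.atSpeed]
  ring

theorem TaskSet.Positive.C_div_D_le_density (hpos : τ.Positive) :
    τ.C k / τ.D k ≤ τ.density k :=
  div_le_div_of_nonneg_left (hpos k).1.le (lt_min (hpos k).2.1 (hpos k).2.2) (min_le_left _ _)

theorem TaskSet.Positive.U_le_density (hpos : τ.Positive) : τ.U k ≤ τ.density k :=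
  div_le_div_of_nonneg_left (hpos k).1.le (lt_min (hpos k).2.1 (hpos k).2.2) (min_le_right _ _)

theorem TaskSet.Positive.D_le_window (hpos : τ.Positive) {ℓ : ℕ} (hℓ : 1 ≤ ℓ) :
    τ.D k ≤ τ.window k ℓ := by
  have h1 : (1 : ℝ) ≤ ℓ := by exact_mod_cast hℓ
  have := mul_nonneg (sub_nonneg.2 h1) (hpos k).2.2.le
  unfold TaskSet.window
  linarith

theorem TaskSet.Positive.window_pos (hpos : τ.Positive) {ℓ : ℕ} (hℓ : 1 ≤ ℓ) :
    0 < τ.window k ℓ :=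
  (hpos k).2.1.trans_le (hpos.D_le_window hℓ)

theorem TaskSet.Positive.demand_div_window_le_density (hpos : τ.Positive) {ℓ : ℕ} (hℓ : 1 ≤ ℓ) :
    (ℓ : ℝ) * τ.C k / τ.window k ℓ ≤ τ.density k := by
  rw [div_le_iff₀ (hpos.window_pos hℓ)]
  have h1 : (1 : ℝ) ≤ ℓ := by exact_mod_cast hℓ
  have hD := (div_le_iff₀ (hpos k).2.1).1 (hpos.C_div_D_le_density (k := k))
  have hT := (div_le_iff₀ (hpos k).2.2).1 (hpos.U_le_density (k := k))
  have := mul_le_mul_of_nonneg_left hT (sub_nonneg.2 h1)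
  unfold TaskSet.window
  linarith

/-- The carry-in term of the linear workload bound is nonnegative. -/
theorem TaskSet.Positive.carryIn_nonneg (hpos : τ.Positive) (hU : ∀ i, τ.U i ≤ 1) (i : Fin N) :
    0 ≤ τ.C i - τ.C i * τ.U i := by
  nlinarith [mul_nonneg (hpos i).1.le (sub_nonneg.2 (hU i))]

end Bounds

/-! ### The linear bound for the workload functions -/

section Workload

variable {N : ℕ} {τ : TaskSet N} {i : Fin N}

/-- The right side is a supporting line of the concave function `min C x` at its corner `x = C`,
with slope between `0` and `1`. -/
theorem min_le_chord {C U x : ℝ} (hU0 : 0 ≤ U) (hU1 : U ≤ 1) :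
    min C x ≤ C - C * U + U * x := by
  rcases le_total x C with h | h
  · rw [min_eq_right h]
    nlinarith [mul_nonneg (sub_nonneg.2 hU1) (sub_nonneg.2 h)]
  · rw [min_eq_left h]
    nlinarith [mul_nonneg hU0 (sub_nonneg.2 h)]

theorem work_le_linear (hpos : τ.Positive) (hU : τ.U i ≤ 1) (Δ : ℝ) :
    τ.work i Δ ≤ τ.C i - τ.C i * τ.U i + τ.U i * Δ := by
  have h := min_le_chord (C := τ.C i) (x := Δ - (⌊Δ / τ.T i⌋ : ℝ) * τ.T i)
    (hpos.U_pos i).le hU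
  have hC : τ.U i * τ.T i = τ.C i := div_mul_cancel₀ _ (hpos i).2.2.ne'
  have e : τ.U i * (Δ - (⌊Δ / τ.T i⌋ : ℝ) * τ.T i)
      = τ.U i * Δ - (⌊Δ / τ.T i⌋ : ℝ) * τ.C i := by rw [← hC]; ring
  unfold TaskSet.work
  linarith

theorem light_le_linear (hpos : τ.Positive) (hU : τ.U i ≤ 1) {ρ : ℝ} (hρ : τ.U i ≤ ρ) (Δ : ℝ) :
    τ.light i ρ Δ ≤ τ.C i - τ.C i * τ.U i + τ.U i * Δ := by
  have hT := (hpos i).2.2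
  unfold TaskSet.light
  split_ifs with hΔ
  · simpa [min_eq_right hΔ] using min_le_chord (C := τ.C i) (x := Δ) (hpos.U_pos i).le hU
  · refine max_le (work_le_linear hpos hU Δ) ?_
    set p : ℝ := (⌈(Δ - τ.C i) / τ.T i⌉ : ℝ) - 1 with hp
    set q : ℝ := Δ - τ.C i - p * τ.T i with hq
    have hC : τ.U i * τ.T i = τ.C i := div_mul_cancel₀ _ hT.ne'
    have hq0 : 0 ≤ q := by
      have h1 : p < (Δ - τ.C i) / τ.T i := by
        have := Int.ceil_lt_add_one ((Δ - τ.C i) / τ.T i)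
        linarith
      have := (lt_div_iff₀ hT).1 h1
      linarith
    have hqT : q ≤ τ.T i := by
      have h1 : (Δ - τ.C i) / τ.T i ≤ p + 1 := by
        have := Int.le_ceil ((Δ - τ.C i) / τ.T i)
        linarith
      have := (div_le_iff₀ hT).1 h1
      linarith
    -- Replacing `ρ` by the smaller `U i` turns the second term into `C i - U i * (T i - q) = U i *
    -- q`.
    have hmax : max 0 (τ.C i - ρ * (τ.T i - q)) ≤ τ.U i * q := by
      refine max_le (mul_nonneg (hpos.U_pos i).le hq0) ?_
      have := mul_le_mul_of_nonneg_right hρ (sub_nonneg.2 hqT)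
      linarith
    have e : τ.C i - τ.C i * τ.U i + τ.U i * Δ = (p + 1) * τ.C i + τ.U i * q := by
      have hΔe : Δ = τ.C i + p * τ.T i + q := by rw [hq]; ring
      rw [hΔe]
      linear_combination p * hC
    linarith

end Workload

/-! ### Relations between the tests -/

theorem exists_isLargest {ι : Type*} (A : Finset ι) (f : ι → ℝ) (m : ℕ) :
    ∃ S, IsLargest A f m S := by
  classical
  induction m with
  | zero => exact ⟨∅, by simp [IsLargest]⟩
  | succ m ih =>
    obtain ⟨S, hSA, hcard, hS⟩ := ih
    rcases le_or_gt A.card m with hm | hm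
    · exact ⟨A, subset_rfl, by omega, fun _ _ j hj hj' => absurd hj hj'⟩
    · have hne : (A \ S).Nonempty := by
        rw [← Finset.card_pos, Finset.card_sdiff_of_subset hSA]
        omega
      obtain ⟨x, hx, hmax⟩ := Finset.exists_max_image (A \ S) f hne
      obtain ⟨hxA, hxS⟩ := Finset.mem_sdiff.1 hx
      refine ⟨insert x S, Finset.insert_subset hxA hSA, ?_, fun i hi j hj hj' => ?_⟩
      · rw [Finset.card_insert_of_notMem hxS]
        omega
      · have hjS : j ∉ S := fun h => hj' (Finset.mem_insert_of_mem h)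
        rcases Finset.mem_insert.1 hi with rfl | hi
        · exact hmax j (Finset.mem_sdiff.2 ⟨hj, hjS⟩)
        · exact hS i hi j hj hjS

section Tests

variable {N M : ℕ} {τ : TaskSet N} {k : Fin N}

/-- Each branch has a smaller left side: `U k` and `C k / D k` are both at most the density, and the
first branch also drops the nonnegative carry-in terms. -/
theorem densityTest.closedFormTest (h : densityTest N M τ k) (hpos : τ.Positive)
    (hU : ∀ i, τ.U i ≤ 1) : closedFormTest N M τ k := by
  refine ⟨fun _ => le_trans ?_ h, fun _ => le_trans ?_ h⟩
  · rw [← Finset.Iio_insert, Finset.sum_insert (by simp)]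
    refine add_le_add hpos.U_le_density (Finset.sum_le_sum fun i _ => ?_)
    have := div_nonneg (hpos.carryIn_nonneg hU i) (hpos k).2.1.le
    linarith
  · exact add_le_add_left hpos.C_div_D_le_density _

theorem densityTest.allEllTest (h : densityTest N M τ k) (hpos : τ.Positive)
    (hU : ∀ i, τ.U i ≤ 1) : allEllTest N M τ k := by
  refine fun ℓ hℓ => le_trans (add_le_add (hpos.demand_div_window_le_density hℓ)
    (Finset.sum_le_sum fun i _ => ?_)) h
  gcongr
  · exact hpos.carryIn_nonneg hU i
  · exact (hpos k).2.1
  · exact hpos.D_le_window hℓ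

theorem allEllTest.linearApproxTest (h : allEllTest N M τ k) (hpos : τ.Positive)
    (hρ : τ.Umax k ≤ 1) : linearApproxTest N M τ k := by
  refine fun ℓ hℓ => ⟨τ.Umax k, hρ,
    (hpos.demand_div_window_le_density hℓ).trans TaskSet.density_le_Umax, ?_⟩
  obtain ⟨S, hS⟩ := exists_isLargest (Iio k)
    (fun i => τ.gamma i (τ.Umax k) * τ.U i * τ.D i) (⌈mu M (τ.Umax k)⌉₊ - 1)
  refine ⟨S, hS, ?_⟩
  -- No task `i < k` has utilization above `Umax k`, so every `gamma` vanishes.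
  have h0 : ∑ i ∈ S, τ.gamma i (τ.Umax k) * τ.U i * τ.D i / τ.window k ℓ = 0 := by
    refine Finset.sum_eq_zero fun i hi => ?_
    simp [TaskSet.gamma, (TaskSet.U_le_Umax (hS.1 hi)).not_gt]
  rw [h0, add_zero]
  exact h ℓ hℓ

theorem allEllTest.workloadTest (h : allEllTest N M τ k) (hpos : τ.Positive)
    (hU : ∀ i, τ.U i ≤ 1) (hρ : τ.Umax k ≤ 1) : workloadTest N M τ k := by
  classical
  refine fun ℓ hℓ => ⟨τ.Umax k, hρ,
    (hpos.demand_div_window_le_density hℓ).trans TaskSet.density_le_Umax, fun Δ hΔ => ?_⟩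
  obtain ⟨S, hS⟩ := exists_isLargest (Iio k)
    (fun i => τ.omegaDiff i (τ.Umax k) Δ) (⌈mu M (τ.Umax k)⌉₊ - 1)
  refine ⟨S, hS, ?_⟩
  have hW := hpos.window_pos (k := k) hℓ
  have hΔ0 : 0 < Δ := hW.trans_le hΔ
  have hC := (hpos k).1
  have hworkload : ∑ i ∈ S, τ.omegaDiff i (τ.Umax k) Δ + ∑ i ∈ Iio k, τ.work i Δ
      ≤ ∑ i ∈ Iio k, (τ.C i - τ.C i * τ.U i + τ.U i * Δ) := by
    -- On `S` the `work` inside `omegaDiff` cancels and leaves `light`; off `S` only `work` remains.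
    -- The same line bounds both, so which tasks are in `S` is irrelevant.
    rw [← Finset.sum_sdiff hS.1, ← Finset.sum_sdiff (f := fun i =>
      τ.C i - τ.C i * τ.U i + τ.U i * Δ) hS.1, add_left_comm, ← Finset.sum_add_distrib]
    refine add_le_add (Finset.sum_le_sum fun i _ => work_le_linear hpos (hU i) Δ)
      (Finset.sum_le_sum fun i hi => ?_)
    have hle := TaskSet.U_le_Umax (τ := τ) (hS.1 hi)
    rw [TaskSet.omegaDiff, if_neg hle.not_gt, sub_add_cancel]
    exact light_le_linear hpos (hU i) hle Δ
  -- After division by `Δ` the left side decreases in `Δ`, so the worst case is `Δ = window k ℓ`.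
  have hdiv : (ℓ : ℝ) * τ.C k / Δ + ∑ i ∈ Iio k, ((τ.C i - τ.C i * τ.U i) / Δ + τ.U i)
      ≤ mu M (τ.Umax k) := by
    refine le_trans (add_le_add ?_ (Finset.sum_le_sum fun i _ => ?_)) (h ℓ hℓ)
    · gcongr
    · gcongr
      exact hpos.carryIn_nonneg hU i
  have hmul := mul_le_mul_of_nonneg_left hdiv hΔ0.le
  rw [mul_add, mul_div_cancel₀ _ hΔ0.ne', Finset.mul_sum] at hmul
  have e : ∀ i ∈ Iio k, Δ * ((τ.C i - τ.C i * τ.U i) / Δ + τ.U i)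
      = τ.C i - τ.C i * τ.U i + τ.U i * Δ := fun i _ => by
    field_simp
  rw [Finset.sum_congr rfl e] at hmul
  linarith

end Tests

/-! ### Speedup bounds -/

section Speedup

variable {N M : ℕ} {τ : TaskSet N}

/-- On a feasible task set the density of task `k`, the interfering execution times relative to
`D k` and the interfering utilizations add up to at most `2 M`. -/
theorem Feasible.density_add_sum_le (h : Feasible M τ) (hpos : τ.Positive)
    (hDM : τ.IsDeadlineMonotonic) (k : Fin N) :
    τ.density k + (∑ i ∈ Iio k, τ.C i / τ.D k + ∑ i ∈ Iio k, τ.U i) ≤ 2 * M := by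
  have hD := (hpos k).2.1
  have hsC : τ.C k / τ.D k + ∑ i ∈ Iio k, τ.C i / τ.D k ≤ M := by
    rw [← Finset.sum_div, ← add_div, div_le_iff₀ hD]
    have := h.sum_C_le hpos hDM k
    rwa [← Finset.Iio_insert, Finset.sum_insert (by simp)] at this
  have hsU : τ.U k + ∑ i ∈ Iio k, τ.U i ≤ M := by
    have := h.sum_U_le hpos (Iic k)
    rwa [← Finset.Iio_insert, Finset.sum_insert (by simp)] at this
  have hCk : 0 ≤ τ.C k / τ.D k := (div_pos (hpos k).1 hD).le
  have hUk := (hpos.U_pos k).le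
  rcases min_choice (τ.D k) (τ.T k) with hm | hm
  · have : τ.density k = τ.C k / τ.D k := by rw [TaskSet.density, hm]
    linarith
  · have : τ.density k = τ.U k := by rw [TaskSet.density, hm, TaskSet.U]
    linarith

theorem one_le_speedup (hM : 2 ≤ M) : (1 : ℝ) ≤ 3 - 1 / M := by
  have hM' : (2 : ℝ) ≤ M := by exact_mod_cast hM
  have : 1 / (M : ℝ) ≤ 1 := (div_le_one (by linarith)).2 (by linarith)
  linarith

theorem Feasible.atSpeed_U_le (h : Feasible M τ) (hpos : τ.Positive) {s : ℝ} (hs : 0 < s)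
    (i : Fin N) : (τ.atSpeed s).U i ≤ 1 / s := by
  rw [τ.atSpeed_U]
  exact div_le_div_of_nonneg_right (h.U_le_one hpos i) hs.le

theorem Feasible.atSpeed_Umax_le (h : Feasible M τ) (hpos : τ.Positive) {s : ℝ} (hs : 0 < s)
    (k : Fin N) : (τ.atSpeed s).Umax k ≤ 1 / s := by
  refine TaskSet.Umax_le ?_ (h.atSpeed_U_le hpos hs)
  rw [τ.atSpeed_density]
  exact div_le_div_of_nonneg_right (h.density_le_one hpos k) hs.le

theorem Feasible.densityTest_atSpeed (hM : 2 ≤ M) (h : Feasible M τ) (hpos : τ.Positive)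
    (hDM : τ.IsDeadlineMonotonic) (k : Fin N) :
    densityTest N M (τ.atSpeed (3 - 1 / (M : ℝ))) k := by
  have hM' : (2 : ℝ) ≤ M := by exact_mod_cast hM
  have hs1 := one_le_speedup hM
  set s : ℝ := 3 - 1 / (M : ℝ) with hs
  have hs0 : 0 < s := by linarith
  have hsM : s * M = 3 * M - 1 := by
    rw [hs, sub_mul, one_div, inv_mul_cancel₀ (by linarith)]
  have hD := (hpos k).2.1
  have hsum : ∑ i ∈ Iio k, (((τ.atSpeed s).C i - (τ.atSpeed s).C i * (τ.atSpeed s).U i)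
      / (τ.atSpeed s).D k + (τ.atSpeed s).U i)
      ≤ (∑ i ∈ Iio k, τ.C i / τ.D k + ∑ i ∈ Iio k, τ.U i) / s := by
    rw [← Finset.sum_add_distrib, Finset.sum_div]
    refine Finset.sum_le_sum fun i _ => ?_
    have hnn : 0 ≤ (τ.atSpeed s).C i * (τ.atSpeed s).U i :=
      mul_nonneg ((hpos.atSpeed hs0) i).1.le ((hpos.atSpeed hs0).U_pos i).le
    have hle := sub_le_self ((τ.atSpeed s).C i) hnn
    rw [add_div, ← τ.atSpeed_U, div_right_comm]
    exact add_le_add_left (div_le_div_of_nonneg_right hle hD.le) _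
  have hmu : (2 * M : ℝ) / s ≤ mu M ((τ.atSpeed s).Umax k) := by
    have hU := mul_le_mul_of_nonneg_left (h.atSpeed_Umax_le hpos hs0 k)
      (by linarith : (0 : ℝ) ≤ M - 1)
    -- This equation is equivalent to `s * M = 3 * M - 1` and thus determines the speedup.
    have e : (2 * M : ℝ) / s = M - (M - 1) * (1 / s) := by
      field_simp
      linarith
    rw [e, mu]
    linarith
  have hdens := div_le_div_of_nonneg_right (h.density_add_sum_le hpos hDM k) hs0.le
  rw [add_div, ← τ.atSpeed_density] at hdens
  unfold densityTest
  linarith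

theorem hasSpeedupBoundDM_of_densityTest (hM : 2 ≤ M) {test : (N M : ℕ) → TaskSet N → Fin N → Prop}
    (htest : ∀ (N : ℕ) (τ : TaskSet N) (k : Fin N), densityTest N M τ k → τ.Positive →
      (∀ i, τ.U i ≤ 1) → τ.Umax k ≤ 1 → test N M τ k) :
    HasSpeedupBoundDM M test (3 - 1 / (M : ℝ)) := by
  have hs1 := one_le_speedup hM
  have hs0 : 0 < 3 - 1 / (M : ℝ) := by linarith
  have hinv : 1 / (3 - 1 / (M : ℝ)) ≤ 1 := (div_le_one hs0).2 hs1
  exact ⟨hs0, fun N τ hpos hDM h k => htest N _ k (h.densityTest_atSpeed hM hpos hDM k)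
    (hpos.atSpeed hs0) (fun i => (h.atSpeed_U_le hpos hs0 i).trans hinv)
    ((h.atSpeed_Umax_le hpos hs0 k).trans hinv)⟩

end Speedup

end Sporadic

theorem theorem5p3 (M : ℕ) (hM : 2 ≤ M) :
    Sporadic.HasSpeedupBoundDM M Sporadic.workloadTest (3 - 1 / (M : ℝ)) ∧
    Sporadic.HasSpeedupBoundDM M Sporadic.linearApproxTest (3 - 1 / (M : ℝ)) ∧
    Sporadic.HasSpeedupBoundDM M Sporadic.allEllTest (3 - 1 / (M : ℝ)) ∧
    Sporadic.HasSpeedupBoundDM M Sporadic.closedFormTest (3 - 1 / (M : ℝ)) ∧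
    Sporadic.HasSpeedupBoundDM M Sporadic.densityTest (3 - 1 / (M : ℝ)) :=
  ⟨Sporadic.hasSpeedupBoundDM_of_densityTest hM fun _ _ _ h hpos hU hρ =>
      (h.allEllTest hpos hU).workloadTest hpos hU hρ,
    Sporadic.hasSpeedupBoundDM_of_densityTest hM fun _ _ _ h hpos hU hρ =>
      (h.allEllTest hpos hU).linearApproxTest hpos hρ,
    Sporadic.hasSpeedupBoundDM_of_densityTest hM fun _ _ _ h hpos hU _ =>
      h.allEllTest hpos hU,
    Sporadic.hasSpeedupBoundDM_of_densityTest hM fun _ _ _ h hpos hU _ =>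
      h.closedFormTest hpos hU,
    Sporadic.hasSpeedupBoundDM_of_densityTest hM fun _ _ _ h _ _ _ => h⟩
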